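/- Let $X$ be a set and $\mathcal M$ a set of maps $X\to X$ that contains the identity and is closed under composition. An *order pair* is a pair $\langle W,S\rangle$ of binary relations on $X$ with $S\subseteq W$. Let the data $\langle\succsim^R,\succ^R\rangle$ be an order pair on $X$ with $\succsim^R$ reflexive. *Rationalizability.* The data are rationalizable by an $\mathcal M$-invariant preference if there is a complete and transitive relation $\succeq$ on $X$, with asymmetric part $\succ$, such that (a) $x\succeq y$ implies $\omega(x)\succeq\omega(y)$ and $x\succ y$ implies $\omega(x)\succ\omega(y)$ for all $x,y\in X$ and $\omega\in\mathcal M$, and (b) ${\succsim^R}\subseteq{\succeq}$ and ${\succ^R}\subseteq{\succ}$. *Broken cycles.* Write $x\succsim^R_\intercal y$ if there is a finite sequence $x=x_0\succsim^R x_1\succsim^R\cdots\succsim^R x_N=y$, and $x\succ^R_\intercal y$ if there is such a sequence in which some consecutive pair belongs to $\succ^R$. A broken cycle consists of $N\ge 1$, $\omega_1,\dots,\omega_N\in\mathcal M$ and $x_1,y_1,\dots,x_N,y_N\in X$ with $$\omega_i(x_i)\succsim^R_\intercal\omega_{i+1}(y_{i+1})\quad(1\le i<N),\qquad \omega_N(x_N)\succsim^R_\intercal\omega_1(y_1);$$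 it is strict if at least one of these $N$ relations also holds with $\succ^R_\intercal$. An order pair $\langle W,S\rangle$ is a forbidden subrelation for the broken cycle if $W=\{(y_i,x_i):1\le i\le N\}$ and, in case the broken cycle is not strict, $S\neq\varnothing$. *Collapse.* A finite order pair $\langle\tilde W,\tilde S\rangle$ is a collapse of the finite order pairs $\langle W_1,S_1\rangle$ and $\langle W_2,S_2\rangle$ if, for $\{i,j\}=\{1,2\}$ in one of the two orders, there are $\omega,\omega'\in\mathcal M$ and $x,y\in X$ with $(\omega(x),\omega(y))\in W_i\setminus S_i$, $(\omega'(y),\omega'(x))\in W_j$, $$\tilde W=\bigl[W_i\setminus\{(\omega(x),\omega(y))\}\bigr]\cup\bigl[W_j\setminus\{(\omega'(y),\omega'(x))\}\bigr],\qquad \tilde S=S_i\cup\bigl[S_j\setminus\{(\omega'(y),\omega'(x))\}\bigr].$$ Let $\mathcal F^0$ be the set of all forbidden subrelations of broken cycles, let $\mathcal F^n$ consist of $\mathcal F^{n-1}$ and all collapses of two (possibly equal) elements of $\mathcal F^{n-1}$, and let $\mathcal F^*=\bigcup_{n\ge0}\mathcal F^n$. The data are *strongly acyclic* if $\langle\varnothing,\varnothing\rangle\notin\mathcal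 F^*$. **Theorem.** The data $\langle\succsim^R,\succ^R\rangle$ are strongly acyclic if and only if they are rationalizable by an $\mathcal M$-invariant preference. -/

import Mathlib

/-- An order pair on `X`: two binary relations (as sets of pairs), the second a sub-relation
of the first. It serves both for data and for restrictions on extensions. -/
@[ext]
structure OrderPair (X : Type*) where
  weak : Set (X × X)
  strict : Set (X × X)
  strict_subset : strict ⊆ weak

namespace OrderPair

variable {X : Type*}

/-- The empty order pair. -/
def empty (X : Type*) : OrderPair X where
  weak := ∅
  strict := ∅
  strict_subset := Set.Subset.rfl

/-- `x = x₀, x₁, …, x_N = y` with each `(x_k, x_{k+1})` in the weak relation. -/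
def Chain (D : OrderPair X) (x y : X) : Prop :=
  Relation.ReflTransGen (fun a b => (a, b) ∈ D.weak) x y

/-- The transitive closure of an order pair: the weak part consists of the pairs joined by a
finite chain of weak relations, the strict part of the pairs joined by such a chain in which
some relation is strict. -/
def transClosure (D : OrderPair X) : OrderPair X where
  weak := {p | D.Chain p.1 p.2}
  strict := {p | ∃ a b, D.Chain p.1 a ∧ (a, b) ∈ D.strict ∧ D.Chain b p.2}
  strict_subset := by
    rintro p ⟨a, b, h₁, h, h₂⟩
    exact h₁.trans (Relation.ReflTransGen.head (D.strict_subset h) h₂)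

end OrderPair

/-- The asymmetric component of a relation. -/
def StrictPart {X : Type*} (r : X → X → Prop) (x y : X) : Prop :=
  r x y ∧ ¬ r y x

/-- A preference relation: complete and transitive. -/
structure IsPreference {X : Type*} (r : X → X → Prop) : Prop where
  complete : ∀ x y, r x y ∨ r y x
  transitive : ∀ x y z, r x y → r y z → r x z

/-- Invariance of a relation under a monoid of transformations, for the weak and for the
strict ranking. -/
structure IsInvariantUnder {X : Type*} (M : Submonoid (Function.End X)) (r : X → X → Prop) :
    Prop where
  weak : ∀ ω ∈ M, ∀ x y, r x y → r (ω x) (ω y)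
  strict : ∀ ω ∈ M, ∀ x y, StrictPart r x y → StrictPart r (ω x) (ω y)

/-- The relation `r` rationalizes the data `D`. -/
structure Rationalizes {X : Type*} (r : X → X → Prop) (D : OrderPair X) : Prop where
  weak : ∀ x y, (x, y) ∈ D.weak → r x y
  strict : ∀ x y, (x, y) ∈ D.strict → StrictPart r x y

/-- The data are rationalizable by an `M`-invariant preference. -/
def IsRationalizable {X : Type*} (M : Submonoid (Function.End X)) (D : OrderPair X) : Prop :=
  ∃ r : X → X → Prop, IsPreference r ∧ IsInvariantUnder M r ∧ Rationalizes r D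

/-- A broken cycle of length `N = n + 1`; the addition `i + 1` in `Fin (n + 1)` is cyclic, so
that the last relation is `ω_N x_N ≿ ω_1 y_1`. -/
structure BrokenCycle {X : Type*} (M : Submonoid (Function.End X)) (D : OrderPair X) where
  n : ℕ
  ω : Fin (n + 1) → Function.End X
  ω_mem : ∀ i, ω i ∈ M
  x : Fin (n + 1) → X
  y : Fin (n + 1) → X
  rel : ∀ i, (ω i (x i), ω (i + 1) (y (i + 1))) ∈ D.transClosure.weak

/-- A broken cycle is strict if one of its relations belongs to the strict part of the
transitive closure. -/
def BrokenCycle.IsStrict {X : Type*} {M : Submonoid (Function.End X)} {D : OrderPair X}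
    (c : BrokenCycle M D) : Prop :=
  ∃ i, (c.ω i (c.x i), c.ω (i + 1) (c.y (i + 1))) ∈ D.transClosure.strict

/-- The order pair `P` is a forbidden subrelation for the broken cycle `c`. -/
def IsForbidden {X : Type*} {M : Submonoid (Function.End X)} {D : OrderPair X}
    (c : BrokenCycle M D) (P : OrderPair X) : Prop :=
  P.weak = Set.range (fun i => (c.y i, c.x i)) ∧ (¬ c.IsStrict → P.strict.Nonempty)

/-- `Q` arises from `P` (in the role of index `i`) and `P'` (in the role of index `j`) by
deleting the mutually exhaustive pair `(ω x, ω y)`, `(ω' y, ω' x)`. -/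
def CollapseAt {X : Type*} (M : Submonoid (Function.End X)) (P P' Q : OrderPair X) : Prop :=
  ∃ ω ∈ M, ∃ ω' ∈ M, ∃ x y : X,
    (ω x, ω y) ∈ P.weak \ P.strict ∧ (ω' y, ω' x) ∈ P'.weak ∧
    Q.weak = (P.weak \ {(ω x, ω y)}) ∪ (P'.weak \ {(ω' y, ω' x)}) ∧
    Q.strict = P.strict ∪ (P'.strict \ {(ω' y, ω' x)})

/-- `Q` is a collapse of the two finite order pairs `P₁` and `P₂`. -/
def IsCollapse {X : Type*} (M : Submonoid (Function.End X)) (P₁ P₂ Q : OrderPair X) : Prop :=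
  P₁.weak.Finite ∧ P₂.weak.Finite ∧ (CollapseAt M P₁ P₂ Q ∨ CollapseAt M P₂ P₁ Q)

/-- The order pairs obtained from forbidden subrelations by at most `n` rounds of collapsing. -/
def restrictions {X : Type*} (M : Submonoid (Function.End X)) (D : OrderPair X) :
    ℕ → Set (OrderPair X)
  | 0 => {P | ∃ c : BrokenCycle M D, IsForbidden c P}
  | n + 1 =>
      {Q | ∃ P₁ ∈ restrictions M D n, ∃ P₂ ∈ restrictions M D n, IsCollapse M P₁ P₂ Q} ∪
        restrictions M D n

/-- Strong acyclicity: the empty order pair is never obtained. -/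
def StronglyAcyclic {X : Type*} (M : Submonoid (Function.End X)) (D : OrderPair X) : Prop :=
  OrderPair.empty X ∉ ⋃ n, restrictions M D n

namespace OrderPair

variable {X : Type*}

/-! The restrictions work like clauses, and a collapse works like a resolution step. An invariant
preference that rationalizes the data extends no forbidden subrelation. If it extends a collapse, it
extends a parent, depending on how it ranks `x` and `y` (`CollapseAt.isExtendedBy_or`). Every
relation extends the empty pair, so that pair is never derived. Conversely, restrictions are finite,
so Zorn gives a maximal order pair `E` containing none of them. By maximality and collapsing, `E`
decides every comparison (`mem_weak_or_mem_strict_of_maximal`). Broken cycles of length at most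
three then make `E.weak` an invariant preference that rationalizes the data. -/

/-- The relation `r` extends the order pair `P`: it respects its weak and its strict part. -/
def IsExtendedBy (P : OrderPair X) (r : X → X → Prop) : Prop :=
  (∀ p ∈ P.weak, r p.1 p.2) ∧ ∀ p ∈ P.strict, StrictPart r p.1 p.2

/-- Componentwise inclusion of order pairs. -/
instance : PartialOrder (OrderPair X) where
  le P Q := P.weak ⊆ Q.weak ∧ P.strict ⊆ Q.strict
  le_refl _ := ⟨Set.Subset.rfl, Set.Subset.rfl⟩
  le_trans _ _ _ h h' := ⟨h.1.trans h'.1, h.2.trans h'.2⟩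
  le_antisymm _ _ h h' := OrderPair.ext (h.1.antisymm h'.1) (h.2.antisymm h'.2)

theorem Chain.of_rationalizes {D : OrderPair X} {r : X → X → Prop} (hr : IsPreference r)
    (hD : Rationalizes r D) {x y : X} (h : D.Chain x y) : r x y := by
  induction h with
  | refl => exact (hr.complete x x).elim id id
  | tail _ hbc ih => exact hr.transitive _ _ _ ih (hD.weak _ _ hbc)

/-! ### Consistent order pairs and Zorn's lemma -/

/-- An order pair is consistent with a family of restrictions if it contains none of them. -/
def IsConsistent (F : Set (OrderPair X)) (E : OrderPair X) : Prop :=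
  ∀ P ∈ F, ¬ P ≤ E

/-- The order pair obtained by adding a weak relation. -/
def insertWeak (E : OrderPair X) (p : X × X) : OrderPair X where
  weak := insert p E.weak
  strict := E.strict
  strict_subset := E.strict_subset.trans (Set.subset_insert _ _)

/-- The order pair obtained by adding a strict relation. -/
def insertStrict (E : OrderPair X) (p : X × X) : OrderPair X where
  weak := insert p E.weak
  strict := insert p E.strict
  strict_subset := Set.insert_subset_insert E.strict_subset

/-- The componentwise union of a family of order pairs. -/
def sUnion (C : Set (OrderPair X)) : OrderPair X where
  weak := ⋃ E ∈ C, E.weak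
  strict := ⋃ E ∈ C, E.strict
  strict_subset := Set.iUnion₂_mono fun E _ => E.strict_subset

/-- Compactness: the finitely many pairs of `P` come from finitely many members of the chain. This
keeps consistency under unions of chains. -/
theorem exists_le_of_le_sUnion {C : Set (OrderPair X)} (hC : IsChain (· ≤ ·) C)
    (hne : C.Nonempty) {P : OrderPair X} (hfin : P.weak.Finite) (hP : P ≤ sUnion C) :
    ∃ E ∈ C, P ≤ E := by
  have hdir : DirectedOn (· ≤ ·) C := hC.directedOn
  obtain ⟨E₁, h₁, hw⟩ := DirectedOn.exists_mem_subset_of_finset_subset_biUnion hne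
    (f := OrderPair.weak) (hdir.mono fun _ _ h => h.1) (s := hfin.toFinset)
    (by rw [hfin.coe_toFinset]; exact hP.1)
  obtain ⟨E₂, h₂, hs⟩ := DirectedOn.exists_mem_subset_of_finset_subset_biUnion hne
    (f := OrderPair.strict) (hdir.mono fun _ _ h => h.2)
    (s := (hfin.subset P.strict_subset).toFinset) (by rw [Set.Finite.coe_toFinset]; exact hP.2)
  obtain ⟨E, hE, hE₁, hE₂⟩ := hdir _ h₁ _ h₂
  rw [Set.Finite.coe_toFinset] at hw hs
  exact ⟨E, hE, hw.trans hE₁.1, hs.trans hE₂.2⟩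

theorem exists_maximal_isConsistent {F : Set (OrderPair X)} (hfin : ∀ P ∈ F, P.weak.Finite)
    (hF : OrderPair.empty X ∉ F) : ∃ E, Maximal (IsConsistent F) E := by
  have hempty : IsConsistent F (OrderPair.empty X) := by
    intro P hP hle
    have : P = OrderPair.empty X :=
      le_antisymm hle ⟨Set.empty_subset _, Set.empty_subset _⟩
    exact hF (this ▸ hP)
  obtain ⟨E, -, hE⟩ := zorn_le_nonempty₀ {E | IsConsistent F E} (fun C hCF hC E₀ hE₀ =>
    ⟨sUnion C, fun P hP hle => by
      obtain ⟨E, hE, hPE⟩ := exists_le_of_le_sUnion hC ⟨E₀, hE₀⟩ (hfin P hP) hle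
      exact hCF hE P hP hPE,
    fun E hE => And.intro (Set.subset_biUnion_of_mem (u := OrderPair.weak) hE)
      (Set.subset_biUnion_of_mem (u := OrderPair.strict) hE)⟩) _ hempty
  exact ⟨E, hE⟩

end OrderPair

/-! ### Rationalizability implies strong acyclicity -/

section

variable {X : Type*} {M : Submonoid (Function.End X)} {D : OrderPair X}

open scoped Fin.CommRing in
theorem IsForbidden.not_isExtendedBy {r : X → X → Prop} (hr : IsPreference r)
    (hM : IsInvariantUnder M r) (hD : Rationalizes r D) {c : BrokenCycle M D} {P : OrderPair X}
    (hP : IsForbidden c P) : ¬ P.IsExtendedBy r := by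
  rintro ⟨hw, hs⟩
  have hyx : ∀ i, r (c.ω i (c.y i)) (c.ω i (c.x i)) := fun i =>
    hM.weak _ (c.ω_mem i) _ _ (hw (c.y i, c.x i) (hP.1 ▸ ⟨i, rfl⟩))
  have hxy : ∀ i, r (c.ω i (c.x i)) (c.ω (i + 1) (c.y (i + 1))) := fun i =>
    OrderPair.Chain.of_rationalizes hr hD (c.rel i)
  -- Walking around the cycle, all its points are indifferent; casting the step count into `Fin`
  -- handles the wrap-around.
  have hcycle : ∀ i j, r (c.ω i (c.y i)) (c.ω j (c.y j)) := by
    intro i j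
    have key : ∀ k : ℕ, r (c.ω i (c.y i))
        (c.ω (i + (k : Fin (c.n + 1))) (c.y (i + (k : Fin (c.n + 1))))) := by
      intro k
      induction k with
      | zero => simpa using (hr.complete _ _).elim id id
      | succ k ih =>
        have h := hr.transitive _ _ _ ih (hr.transitive _ _ _ (hyx _) (hxy _))
        rwa [add_assoc, ← Nat.cast_succ] at h
    have h := key (j - i : Fin (c.n + 1)).val
    rwa [Fin.cast_val_eq_self, add_sub_cancel] at h
  by_cases hc : c.IsStrict
  · obtain ⟨i, a, b, hxa, hab, hby⟩ := hc
    refine (hD.strict _ _ hab).2 (hr.transitive _ _ _ (hby.of_rationalizes hr hD) ?_)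
    exact hr.transitive _ _ _ (hcycle (i + 1) i)
      (hr.transitive _ _ _ (hyx i) (hxa.of_rationalizes hr hD))
  · obtain ⟨p, hp⟩ := hP.2 hc
    obtain ⟨i, rfl⟩ : p ∈ Set.range fun i => (c.y i, c.x i) := hP.1 ▸ P.strict_subset hp
    exact (hM.strict _ (c.ω_mem i) _ _ (hs _ hp)).2
      (hr.transitive _ _ _ (hxy i) (hcycle (i + 1) i))

theorem CollapseAt.isExtendedBy_or {r : X → X → Prop} (hr : IsPreference r)
    (hM : IsInvariantUnder M r) {P P' Q : OrderPair X} (h : CollapseAt M P P' Q)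
    (hQ : Q.IsExtendedBy r) : P.IsExtendedBy r ∨ P'.IsExtendedBy r := by
  obtain ⟨ω, hω, ω', hω', x, y, -, -, hw, hs⟩ := h
  by_cases hxy : r x y
  -- The pair deleted from `P` is only needed weakly, since `Q` keeps all of `P.strict`.
  · refine Or.inl ⟨fun p hp => ?_, fun p hp => hQ.2 p (hs ▸ Or.inl hp)⟩
    by_cases hpe : p = (ω x, ω y)
    · subst hpe
      exact hM.weak ω hω x y hxy
    · exact hQ.1 p (hw ▸ Or.inl ⟨hp, hpe⟩)
  · have hyx := hM.strict ω' hω' y x ⟨(hr.complete x y).resolve_left hxy, hxy⟩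
    refine Or.inr ⟨fun p hp => ?_, fun p hp => ?_⟩ <;> by_cases hpe : p = (ω' y, ω' x)
    · subst hpe
      exact hyx.1
    · exact hQ.1 p (hw ▸ Or.inr ⟨hp, hpe⟩)
    · subst hpe
      exact hyx
    · exact hQ.2 p (hs ▸ Or.inr ⟨hp, hpe⟩)

theorem not_isExtendedBy_of_mem_restrictions {r : X → X → Prop} (hr : IsPreference r)
    (hM : IsInvariantUnder M r) (hD : Rationalizes r D) {n : ℕ} {P : OrderPair X}
    (hP : P ∈ restrictions M D n) : ¬ P.IsExtendedBy r := by
  induction n generalizing P with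
  | zero =>
    obtain ⟨c, hc⟩ := hP
    exact hc.not_isExtendedBy hr hM hD
  | succ n ih =>
    rcases hP with ⟨P₁, h₁, P₂, h₂, -, -, h | h⟩ | hP
    · exact fun hext => (h.isExtendedBy_or hr hM hext).elim (ih h₁) (ih h₂)
    · exact fun hext => (h.isExtendedBy_or hr hM hext).elim (ih h₂) (ih h₁)
    · exact ih hP

theorem IsRationalizable.stronglyAcyclic (h : IsRationalizable M D) : StronglyAcyclic M D := by
  obtain ⟨r, hr, hM, hD⟩ := h
  intro hmem
  obtain ⟨n, hn⟩ := Set.mem_iUnion.1 hmem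
  exact not_isExtendedBy_of_mem_restrictions hr hM hD hn
    ⟨fun _ hp => hp.elim, fun _ hp => hp.elim⟩

/-! ### Strong acyclicity implies rationalizability -/

theorem CollapseAt.finite {P P' Q : OrderPair X} (h : CollapseAt M P P' Q)
    (hP : P.weak.Finite) (hP' : P'.weak.Finite) : Q.weak.Finite := by
  obtain ⟨ω, -, ω', -, x, y, -, -, hw, -⟩ := h
  exact hw ▸ hP.sdiff.union hP'.sdiff

theorem finite_of_mem_restrictions {n : ℕ} {P : OrderPair X} (hP : P ∈ restrictions M D n) :
    P.weak.Finite := by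
  induction n with
  | zero =>
    obtain ⟨c, hc, -⟩ := hP
    exact hc ▸ Set.finite_range _
  | succ n ih =>
    rcases hP with ⟨P₁, -, P₂, -, hf₁, hf₂, h | h⟩ | hP
    · exact h.finite hf₁ hf₂
    · exact h.finite hf₂ hf₁
    · exact ih hP

theorem restrictions_mono : Monotone (restrictions M D) :=
  monotone_nat_of_le_succ fun _ => Set.subset_union_right

theorem CollapseAt.mem_restrictions {P P' Q : OrderPair X} (h : CollapseAt M P P' Q)
    (hP : P ∈ ⋃ n, restrictions M D n) (hP' : P' ∈ ⋃ n, restrictions M D n) :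
    Q ∈ ⋃ n, restrictions M D n := by
  obtain ⟨m, hm⟩ := Set.mem_iUnion.1 hP
  obtain ⟨n, hn⟩ := Set.mem_iUnion.1 hP'
  exact Set.mem_iUnion.2 ⟨max m n + 1, Or.inl ⟨P, restrictions_mono (le_max_left m n) hm,
    P', restrictions_mono (le_max_right m n) hn,
    finite_of_mem_restrictions hm, finite_of_mem_restrictions hn, Or.inl h⟩⟩

/-- A maximal consistent order pair decides every comparison: otherwise, the restrictions that
exclude the two possible additions have a collapse contained in the order pair. -/
theorem mem_weak_or_mem_strict_of_maximal {E : OrderPair X}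
    (hE : Maximal (OrderPair.IsConsistent (⋃ n, restrictions M D n)) E) (x y : X) :
    (x, y) ∈ E.weak ∨ (y, x) ∈ E.strict := by
  by_contra! hxy
  obtain ⟨hw, hs⟩ := hxy
  have h₁ : ¬ OrderPair.IsConsistent (⋃ n, restrictions M D n) (E.insertWeak (x, y)) :=
    fun h => hw ((hE.2 h ⟨Set.subset_insert _ _, Set.Subset.rfl⟩).1 (Set.mem_insert _ _))
  have h₂ : ¬ OrderPair.IsConsistent (⋃ n, restrictions M D n) (E.insertStrict (y, x)) :=
    fun h => hs ((hE.2 h ⟨Set.subset_insert _ _, Set.subset_insert _ _⟩).2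
      (Set.mem_insert _ _))
  simp only [OrderPair.IsConsistent, not_forall, not_not] at h₁ h₂
  obtain ⟨P₁, hP₁, hw₁, hs₁⟩ := h₁
  obtain ⟨P₂, hP₂, hw₂, hs₂⟩ := h₂
  have hd₁ : P₁.weak \ {(x, y)} ⊆ E.weak := Set.sdiff_singleton_subset_iff.2 hw₁
  have hd₂ : P₂.weak \ {(y, x)} ⊆ E.weak := Set.sdiff_singleton_subset_iff.2 hw₂
  have hd₃ : P₂.strict \ {(y, x)} ⊆ E.strict := Set.sdiff_singleton_subset_iff.2 hs₂
  -- Only a weak relation was added, so `P₁.strict` already lies in `E.strict`.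
  have hns : (x, y) ∉ P₁.strict := fun h => hw (E.strict_subset (hs₁ h))
  have hmem₁ : (x, y) ∈ P₁.weak := by
    by_contra h
    exact hE.1 P₁ hP₁ ⟨Set.sdiff_singleton_eq_self h ▸ hd₁, hs₁⟩
  have hmem₂ : (y, x) ∈ P₂.weak := by
    by_contra h
    exact hE.1 P₂ hP₂ ⟨Set.sdiff_singleton_eq_self h ▸ hd₂,
      Set.sdiff_singleton_eq_self (fun h' => h (P₂.strict_subset h')) ▸ hd₃⟩
  let Q : OrderPair X :=
    { weak := (P₁.weak \ {(x, y)}) ∪ (P₂.weak \ {(y, x)})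
      strict := P₁.strict ∪ (P₂.strict \ {(y, x)})
      strict_subset := Set.union_subset_union
        (Set.subset_sdiff_singleton P₁.strict_subset hns)
        (Set.sdiff_subset_sdiff_left P₂.strict_subset) }
  -- Collapsing with identity maps suffices here; invariance comes later, from broken cycles of
  -- length two.
  have hQ : CollapseAt M P₁ P₂ Q :=
    ⟨1, M.one_mem, 1, M.one_mem, x, y, ⟨hmem₁, hns⟩, hmem₂, rfl, rfl⟩
  exact hE.1 Q (hQ.mem_restrictions hP₁ hP₂)
    ⟨Set.union_subset hd₁ hd₂, Set.union_subset hs₁ hd₃⟩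

/-- A consistent order pair that contains all pairs `(y_i, x_i)` of a broken cycle ranks none of
them strictly, and the broken cycle is not strict. -/
theorem BrokenCycle.not_isStrict_and_notMem_strict {E : OrderPair X}
    (hE : OrderPair.IsConsistent (⋃ n, restrictions M D n) E) (c : BrokenCycle M D)
    (hc : ∀ i, (c.y i, c.x i) ∈ E.weak) :
    ¬ c.IsStrict ∧ ∀ i, (c.y i, c.x i) ∉ E.strict := by
  let P : OrderPair X :=
    { weak := Set.range fun i => (c.y i, c.x i)
      strict := (Set.range fun i => (c.y i, c.x i)) ∩ E.strict
      strict_subset := Set.inter_subset_left }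
  have hPE : P ≤ E := ⟨Set.range_subset_iff.2 hc, Set.inter_subset_right⟩
  have hP : ¬ IsForbidden c P := fun h => hE P (Set.mem_iUnion.2 ⟨0, c, h⟩) hPE
  exact ⟨fun h => hP ⟨rfl, fun h' => absurd h h'⟩,
    fun i hi => hP ⟨rfl, fun _ => ⟨_, ⟨i, rfl⟩, hi⟩⟩⟩

/-- The broken cycle of length one given by a chain. -/
def BrokenCycle.single (M : Submonoid (Function.End X)) {x y : X} (h : D.Chain x y) :
    BrokenCycle M D where
  n := 0
  ω _ := 1
  ω_mem _ := M.one_mem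
  x _ := x
  y _ := y
  rel _ := h

/-- The broken cycle of length two that uses only reflexivity of the chain relation. -/
def BrokenCycle.pair (D : OrderPair X) {ω : Function.End X} (hω : ω ∈ M) (x y : X) :
    BrokenCycle M D where
  n := 1
  ω := ![ω, 1]
  ω_mem := by
    intro i
    fin_cases i
    exacts [hω, M.one_mem]
  x := ![y, ω x]
  y := ![x, ω y]
  rel := by
    intro i
    fin_cases i <;> exact Relation.ReflTransGen.refl

/-- The broken cycle of length three that uses only reflexivity of the chain relation. -/
def BrokenCycle.triple (M : Submonoid (Function.End X)) (D : OrderPair X) (x y z : X) :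
    BrokenCycle M D where
  n := 2
  ω _ := 1
  ω_mem _ := M.one_mem
  x := ![y, z, x]
  y := ![x, y, z]
  rel := by
    intro i
    fin_cases i <;> exact Relation.ReflTransGen.refl

theorem StronglyAcyclic.isRationalizable (h : StronglyAcyclic M D) : IsRationalizable M D := by
  obtain ⟨E, hE⟩ := OrderPair.exists_maximal_isConsistent (fun P hP => by
    obtain ⟨n, hn⟩ := Set.mem_iUnion.1 hP
    exact finite_of_mem_restrictions hn) h
  have htot := mem_weak_or_mem_strict_of_maximal hE
  -- For `ω = 1` this is compatibility of `E.strict` with `E.weak`; for general `ω` it yields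
  -- invariance.
  have hpair : ∀ ω ∈ M, ∀ x y, (x, y) ∈ E.weak → (ω y, ω x) ∈ E.weak →
      (x, y) ∉ E.strict ∧ (ω y, ω x) ∉ E.strict := by
    intro ω hω x y h₁ h₂
    have := ((BrokenCycle.pair D hω x y).not_isStrict_and_notMem_strict hE.1 (by
      intro i
      change Fin 2 at i
      fin_cases i
      exacts [h₁, h₂])).2
    exact ⟨this (0 : Fin 2), this (1 : Fin 2)⟩
  have hstrict : ∀ x y, (x, y) ∈ E.strict ↔ StrictPart (fun a b => (a, b) ∈ E.weak) x y :=
    fun x y => ⟨fun hs => ⟨E.strict_subset hs, fun hw =>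
      (hpair 1 M.one_mem x y (E.strict_subset hs) hw).1 hs⟩,
      fun hs => (htot y x).resolve_left hs.2⟩
  refine ⟨fun a b => (a, b) ∈ E.weak, ⟨fun x y => ?_, fun x y z hxy hyz => ?_⟩,
    ⟨fun ω hω x y hxy => ?_, fun ω hω x y hxy => ?_⟩, ⟨fun x y hxy => ?_, fun x y hxy => ?_⟩⟩
  · exact (htot x y).imp_right fun hs => E.strict_subset hs
  · refine (htot x z).resolve_right fun hs => ?_
    exact ((BrokenCycle.triple M D x y z).not_isStrict_and_notMem_strict hE.1 (by
      intro i
      change Fin 3 at i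
      fin_cases i
      exacts [hxy, hyz, E.strict_subset hs])).2 (2 : Fin 3) hs
  · exact (htot (ω x) (ω y)).resolve_right fun hs =>
      (hpair ω hω x y hxy (E.strict_subset hs)).2 hs
  · refine (hstrict _ _).1 ((htot (ω y) (ω x)).resolve_left fun hw => ?_)
    exact (hpair ω hω x y hxy.1 hw).1 ((hstrict x y).2 hxy)
  · refine (htot x y).resolve_right fun hs => ?_
    exact ((BrokenCycle.single M (.single hxy)).not_isStrict_and_notMem_strict hE.1
      (fun _ => E.strict_subset hs)).2 0 hs
  · refine (hstrict x y).1 ((htot y x).resolve_left fun hw => ?_)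
    -- The strict datum makes this one-step cycle strict, so even the weak reversal is excluded.
    refine ((BrokenCycle.single M (.single (D.strict_subset hxy))).not_isStrict_and_notMem_strict
      hE.1 (fun _ => hw)).1 ⟨0, x, y, .refl, hxy, .refl⟩

end

theorem theorem2 {X : Type*} (M : Submonoid (Function.End X)) (D : OrderPair X)
    (hrefl : ∀ x : X, (x, x) ∈ D.weak) :
    StronglyAcyclic M D ↔ IsRationalizable M D :=
  ⟨StronglyAcyclic.isRationalizable, IsRationalizable.stronglyAcyclic⟩
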